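/- Let $V$ be a reflexive real Banach space, let $E$ be a real normed space with topological dual $E^*$, let $x_0\in V$ and $r>0$, and let $X=\{x\in V:\|x-x_0\|<r\}$. Let $\gamma:[0,r)\to\mathbb R$ satisfy $\lim_{\xi\to r^-}\gamma(\xi)=+\infty$, and let $I:X\to\mathbb R$ and $\psi:X\to E$ be Gâteaux differentiable, that is, at each $x\in X$ there are continuous linear operators $I'(x):V\to\mathbb R$ and $\psi'(x):V\to E$ giving all directional derivatives at $x$. Assume that $I$ is sequentially weakly lower semicontinuous on $X$, that $\psi$ is sequentially weakly continuous (for every sequence $(x_n)$ in $X$ converging weakly to some $x\in X$, $\psi(x_n)$ converges weakly to $\psi(x)$ in $E$), that $\psi(X)$ is bounded and not convex, and that $\gamma(\|x-x_0\|)\le I(x)$ for all $x\in X$. Then, for every convex set $S\subseteq E^*$ that is weak-star dense in $E^*$, there exists $\tilde\eta\in S$ such that the equation $$I'(x)+(\tilde\eta\circ\psi)'(x)=0$$ (in $V^*$, the derivatives being Gâteaux derivatives) has at least two distinct solutions $x\in X$. -/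

import Mathlib

open Set Filter Topology

/-- `f'` is the Gâteaux derivative of `f` at `x`: a continuous linear operator such that
`(f (x + t • v) - f x) / t → f' v` as `t → 0`, `t ≠ 0`, for every direction `v`. -/
def HasGateauxDerivAt {V F : Type*} [NormedAddCommGroup V] [NormedSpace ℝ V]
    [NormedAddCommGroup F] [NormedSpace ℝ F] (f : V → F) (f' : V →L[ℝ] F) (x : V) : Prop :=
  ∀ v : V, HasLineDerivAt ℝ f (f' v) x v

/-- `f` is Gâteaux differentiable at every point of the set `X` (used for open `X`, where only
the values of `f` on `X` matter). -/
def GateauxDifferentiableOn {V F : Type*} [NormedAddCommGroup V] [NormedSpace ℝ V]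
    [NormedAddCommGroup F] [NormedSpace ℝ F] (f : V → F) (X : Set V) : Prop :=
  ∀ x ∈ X, ∃ f' : V →L[ℝ] F, HasGateauxDerivAt f f' x

/-- A normed space is reflexive if the canonical map into its bidual is onto. -/
def IsReflexiveSpace (V : Type*) [NormedAddCommGroup V] [NormedSpace ℝ V] : Prop :=
  Function.Surjective (NormedSpace.inclusionInDoubleDual ℝ V)

/-- The sequence `u` converges weakly to `x`. -/
def WeaklyTendsto {V : Type*} [NormedAddCommGroup V] [NormedSpace ℝ V] (u : ℕ → V) (x : V) :
    Prop :=
  Tendsto (fun n => toWeakSpace ℝ V (u n)) atTop (𝓝 (toWeakSpace ℝ V x))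

/-- `f` is sequentially weakly lower semicontinuous on `X`: `f x ≤ liminf f (u n)`, the lower limit
being taken in the extended reals, whenever `u n → x` weakly, with all `u n` and `x` in `X`. -/
def SeqWeaklyLowerSemicontinuousOn {V : Type*} [NormedAddCommGroup V] [NormedSpace ℝ V]
    (f : V → ℝ) (X : Set V) : Prop :=
  ∀ (u : ℕ → V) (x : V), (∀ n, u n ∈ X) → x ∈ X → WeaklyTendsto u x →
    ((f x : ℝ) : EReal) ≤ liminf (fun n => ((f (u n) : ℝ) : EReal)) atTop

/-- `f` is sequentially weakly continuous on `X`: `f (u n) → f x` weakly whenever `u n → x` weakly,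
with all `u n` and `x` in `X`. -/
def SeqWeaklyContinuousOn {V E : Type*} [NormedAddCommGroup V] [NormedSpace ℝ V]
    [NormedAddCommGroup E] [NormedSpace ℝ E] (f : V → E) (X : Set V) : Prop :=
  ∀ (u : ℕ → V) (x : V), (∀ n, u n ∈ X) → x ∈ X → WeaklyTendsto u x →
    WeaklyTendsto (fun n => f (u n)) (f x)

/-- `S` is dense in the dual of `E` for the weak-star topology. -/
def WeakStarDense {E : Type*} [NormedAddCommGroup E] [NormedSpace ℝ E]
    (S : Set (StrongDual ℝ E)) : Prop :=
  Dense (StrongDual.toWeakDual '' S : Set (WeakDual ℝ E))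

/-- If `g + L · p` has compact sublevel sets and at most one minimiser on `s` for every `p` in a
convex set `S`, with minimal values bounded by `M`, then finitely many of these functions are
simultaneously bounded by `M` at some point of `s`. -/
theorem exists_forall_le_of_unique_minimizer_fintype {X P ι : Type*} [TopologicalSpace X]
    [T2Space X] [AddCommGroup P] [Module ℝ P] [Fintype ι] [Nonempty ι] {s : Set X} {S : Set P}
    (hS : Convex ℝ S) (g : X → ℝ) (L : X → P →ₗ[ℝ] ℝ) {M : ℝ}
    (hc : ∀ p ∈ S, ∀ c, IsCompact {x ∈ s | g x + L x p ≤ c})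
    (huniq : ∀ p ∈ S, ∀ x ∈ s, ∀ y ∈ s, IsMinOn (fun z => g z + L z p) s x →
      IsMinOn (fun z => g z + L z p) s y → x = y)
    (hM : ∀ p ∈ S, ∃ x ∈ s, g x + L x p ≤ M) (q : ι → P) (hq : ∀ i, q i ∈ S) :
    ∃ x ∈ s, ∀ i, g x + L x (q i) ≤ M := by
  classical
  have hmin : ∀ p ∈ S, ∃ x ∈ s, IsMinOn (fun z => g z + L z p) s x := by
    intro p hp
    obtain ⟨a, ha, -⟩ := hM p hp
    have : Nonempty s := ⟨⟨a, ha⟩⟩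
    obtain ⟨x, hx⟩ := IsCompact.nonempty_iInter_of_directed_nonempty_isCompact_isClosed
      (fun b : s => {x ∈ s | g x + L x p ≤ g b + L b p})
      (by
        intro b b'
        rcases le_total (g b + L b p) (g b' + L b' p) with h | h
        · exact ⟨b, fun x hx => hx, fun x hx => ⟨hx.1, hx.2.trans h⟩⟩
        · exact ⟨b', fun x hx => ⟨hx.1, hx.2.trans h⟩, fun x hx => hx⟩)
      (fun b => ⟨b, b.2, le_rfl⟩) (fun b => hc p hp _) (fun b => (hc p hp _).isClosed)
    simp only [mem_iInter] at hx
    exact ⟨x, (hx ⟨a, ha⟩).1, fun b hb => (hx ⟨b, hb⟩).2⟩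
  let p : (ι → ℝ) → P := fun w => ∑ i, w i • q i
  have hp : ∀ w ∈ stdSimplex ℝ ι, p w ∈ S := fun w hw =>
    hS.sum_mem (fun i _ => hw.1 i) hw.2 (fun i _ => hq i)
  have : Nonempty X := ⟨(hM _ (hq (Classical.arbitrary ι))).choose⟩
  choose! m hms hmin using hmin
  have hcont : ∀ x, Continuous fun w => g x + L x (p w) := by
    intro x
    simp only [p, map_sum, map_smul, smul_eq_mul]
    fun_prop
  have husc : UpperSemicontinuousOn (fun w => g (m (p w)) + L (m (p w)) (p w))
      (stdSimplex ℝ ι) := by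
    intro w hw c hcw
    have h := (hcont (m (p w))).continuousAt.eventually_lt_const hcw
    filter_upwards [mem_nhdsWithin_of_mem_nhds h, self_mem_nhdsWithin] with v hv hvs
    exact (hmin _ (hp v hvs) (hms _ (hp w hw))).trans_lt hv
  have hne : (stdSimplex ℝ ι).Nonempty :=
    ⟨_, single_mem_stdSimplex ℝ (Classical.arbitrary ι)⟩
  obtain ⟨w, hw, hmax⟩ := husc.exists_isMaxOn hne (isCompact_stdSimplex ℝ ι)
  set x₁ := m (p w) with hx₁
  set G := g x₁ + L x₁ (p w) with hG
  have hx₁s : x₁ ∈ s := hms _ (hp w hw)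
  have hGM : G ≤ M := by
    obtain ⟨x, hx, hxM⟩ := hM _ (hp w hw)
    exact (hmin _ (hp w hw) hx).trans hxM
  refine ⟨x₁, hx₁s, fun i => le_trans ?_ hGM⟩
  have key : ∀ ε : ℝ, 0 < ε →
      ({x ∈ s | g x + L x (q i) ≤ G} ∩ {x ∈ s | g x + L x (p w) ≤ G + ε}).Nonempty := by
    intro ε hε
    obtain ⟨b, hb⟩ : ∃ b, b = g (m (q i)) + L (m (q i)) (q i) := ⟨_, rfl⟩
    obtain ⟨t, ht0, ht1, ht⟩ : ∃ t : ℝ, 0 < t ∧ t < 1 ∧ t * (G + ε - b) ≤ ε := by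
      have h1 : Tendsto (fun t : ℝ => t * (G + ε - b)) (𝓝[>] 0) (𝓝 (0 * (G + ε - b))) :=
        ((continuous_id.mul continuous_const).tendsto 0).mono_left nhdsWithin_le_nhds
      rw [zero_mul] at h1
      have h2 := (h1.eventually_le_const hε).and (Ioo_mem_nhdsGT (zero_lt_one (α := ℝ)))
      obtain ⟨t, h3, h4⟩ := h2.exists
      exact ⟨t, h4.1, h4.2, h3⟩
    let v : ι → ℝ := (1 - t) • w + t • Pi.single i 1
    have hv : v ∈ stdSimplex ℝ ι :=
      convex_stdSimplex ℝ ι hw (single_mem_stdSimplex ℝ i) (by linarith) ht0.le (by ring)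
    have hpv : p v = (1 - t) • p w + t • q i := by
      simp [p, v, add_smul, Finset.sum_add_distrib, mul_smul, Finset.smul_sum, Pi.single_apply,
        ite_smul]
    have hys := hms _ (hp v hv)
    set y := m (p v)
    have h1 : g y + L y (p v) ≤ G := hmax hv
    have h2 : G ≤ g y + L y (p w) := hmin _ (hp w hw) hys
    have h3 : b ≤ g y + L y (q i) := hb ▸ hmin _ (hq i) hys
    rw [hpv, map_add, map_smul, map_smul, smul_eq_mul, smul_eq_mul] at h1
    refine ⟨y, ⟨hys, ?_⟩, ⟨hys, ?_⟩⟩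
    · nlinarith
    · nlinarith
  have : Nonempty (Ioi (0 : ℝ)) := ⟨⟨1, mem_Ioi.2 one_pos⟩⟩
  obtain ⟨x, hx⟩ := IsCompact.nonempty_iInter_of_directed_nonempty_isCompact_isClosed
    (fun ε : Ioi (0 : ℝ) =>
      {x ∈ s | g x + L x (q i) ≤ G} ∩ {x ∈ s | g x + L x (p w) ≤ G + ε})
    (by
      intro b b'
      rcases le_total (b : ℝ) b' with h | h
      · exact ⟨b, fun x hx => hx, fun x hx => ⟨hx.1, hx.2.1, hx.2.2.trans (by gcongr)⟩⟩
      · exact ⟨b', fun x hx => ⟨hx.1, hx.2.1, hx.2.2.trans (by gcongr)⟩, fun x hx => hx⟩)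
    (fun b => key b b.2) (fun b => (hc _ (hq i) _).inter_right (hc _ (hp w hw) _).isClosed)
    (fun b => (hc _ (hq i) _).isClosed.inter (hc _ (hp w hw) _).isClosed)
  simp only [mem_iInter] at hx
  have hxG : g x + L x (p w) ≤ G :=
    le_of_forall_pos_le_add fun ε hε => (hx ⟨ε, hε⟩).2.2
  have hxs : x ∈ s := (hx ⟨1, mem_Ioi.2 one_pos⟩).1.1
  have : x = x₁ := huniq _ (hp w hw) x hxs x₁ hx₁s
    (fun z hz => hxG.trans (hmin _ (hp w hw) hz)) (hmin _ (hp w hw))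
  exact this ▸ (hx ⟨1, mem_Ioi.2 one_pos⟩).1.2

/-- A minimax principle: if `g + L · p` has compact sublevel sets and at most one minimiser on `s`
for every `p` in a convex set `S`, with minimal values bounded by `M`, then all these functions are
simultaneously bounded by `M` at some point of `s`. -/
theorem exists_forall_le_of_unique_minimizer {X P : Type*} [TopologicalSpace X]
    [T2Space X] [AddCommGroup P] [Module ℝ P] {s : Set X} {S : Set P}
    (hS : Convex ℝ S) (hSne : S.Nonempty) (g : X → ℝ) (L : X → P →ₗ[ℝ] ℝ) {M : ℝ}
    (hc : ∀ p ∈ S, ∀ c, IsCompact {x ∈ s | g x + L x p ≤ c})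
    (huniq : ∀ p ∈ S, ∀ x ∈ s, ∀ y ∈ s, IsMinOn (fun z => g z + L z p) s x →
      IsMinOn (fun z => g z + L z p) s y → x = y)
    (hM : ∀ p ∈ S, ∃ x ∈ s, g x + L x p ≤ M) :
    ∃ x ∈ s, ∀ p ∈ S, g x + L x p ≤ M := by
  classical
  obtain ⟨p₀, hp₀⟩ := hSne
  obtain ⟨x, hx₀, hx⟩ := (hc p₀ hp₀ M).inter_iInter_nonempty
    (fun p : S => {x ∈ s | g x + L x p ≤ M}) (fun p => (hc p p.2 M).isClosed) (by
      intro u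
      let v : Finset S := insert ⟨p₀, hp₀⟩ u
      have : Nonempty v := ⟨⟨⟨p₀, hp₀⟩, Finset.mem_insert_self _ _⟩⟩
      obtain ⟨x, hxs, hx⟩ := exists_forall_le_of_unique_minimizer_fintype hS g L hc huniq hM
        (fun i : v => ((i : S) : P)) (fun i => (i : S).2)
      refine ⟨x, ⟨hxs, hx ⟨⟨p₀, hp₀⟩, Finset.mem_insert_self _ _⟩⟩, ?_⟩
      simp only [mem_iInter]
      exact fun i hi => ⟨hxs, hx ⟨i, Finset.mem_insert_of_mem hi⟩⟩)
  simp only [mem_iInter] at hx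
  exact ⟨x, hx₀.1, fun p hp => (hx ⟨p, hp⟩).2⟩

instance WeakSpace.t2Space_real (V : Type*) [NormedAddCommGroup V] [NormedSpace ℝ V] :
    T2Space (WeakSpace ℝ V) :=
  (NormedSpace.isEmbedding_inclusionInDoubleDualWeak ℝ V).t2Space

section

variable {V : Type*} [NormedAddCommGroup V] [NormedSpace ℝ V]

theorem IsReflexiveSpace.isCompact_closure_toWeakSpace_image (hV : IsReflexiveSpace V) {A : Set V}
    (hA : Bornology.IsBounded A) : IsCompact (closure (toWeakSpace ℝ V '' A)) := by
  refine NormedSpace.isCompact_closure_of_isBounded ℝ V _ ?_ ?_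
  · rwa [preimage_image_eq _ (toWeakSpace ℝ V).injective]
  · intro y _
    obtain ⟨x, hx⟩ := hV (WeakDual.toStrongDual y)
    refine ⟨toWeakSpace ℝ V x, ?_⟩
    apply WeakDual.toStrongDual.injective
    rw [← hx]
    rfl

theorem continuous_weakSpace_eval (φ : StrongDual ℝ V) :
    Continuous fun x : WeakSpace ℝ V => φ ((toWeakSpace ℝ V).symm x) :=
  WeakBilin.eval_continuous (topDualPairing ℝ V).flip φ

/-- Finitely many functionals of norm at most one suffice to norm a finite-dimensional subspace up
to a factor `2`. -/
theorem exists_finset_dual_norming (F : Submodule ℝ V) [FiniteDimensional ℝ F] :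
    ∃ Φ : Finset (StrongDual ℝ V), ∀ w ∈ F, ∃ φ ∈ Φ, ‖φ‖ ≤ 1 ∧ ‖w‖ ≤ 2 * φ w := by
  classical
  have hK : IsCompact (Metric.sphere (0 : F) 1) := isCompact_sphere 0 1
  obtain ⟨t, ht⟩ := hK.elim_finite_subcover
    (fun φ : {φ : StrongDual ℝ V // ‖φ‖ ≤ 1} => {w : F | 1 / 2 < φ.1 (w : V)})
    (fun φ => isOpen_lt continuous_const (φ.1.continuous.comp continuous_subtype_val))
    (by
      intro w hw
      obtain ⟨φ, hφ, hφw⟩ := exists_dual_vector'' ℝ (w : V)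
      have : ‖(w : V)‖ = 1 := by simpa using hw
      simp only [mem_iUnion]
      refine ⟨⟨φ, hφ⟩, ?_⟩
      simp [hφw, this]
      norm_num)
  refine ⟨insert 0 (t.image Subtype.val), fun w hw => ?_⟩
  rcases eq_or_ne w 0 with rfl | hw0
  · exact ⟨0, by simp, by simp, by simp⟩
  have hpos : 0 < ‖w‖ := norm_pos_iff.2 hw0
  have hmem : (‖w‖⁻¹ • (⟨w, hw⟩ : F)) ∈ Metric.sphere (0 : F) 1 := by
    simp [norm_smul, hpos.ne']
  have := ht hmem
  simp only [mem_iUnion] at this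
  obtain ⟨φ, hφt, hφ⟩ := this
  refine ⟨φ, Finset.mem_insert_of_mem (Finset.mem_image_of_mem _ hφt), φ.2, ?_⟩
  simp only [mem_ofPred_eq, Submodule.coe_smul, map_smul, smul_eq_mul] at hφ
  rw [lt_inv_mul_iff₀ hpos] at hφ
  linarith

/-- A point of the weak closure of a set can be approximated by elements of the set on finitely
many functionals. -/
theorem exists_mem_forall_abs_sub_lt {A : Set V} {x : V}
    (hx : toWeakSpace ℝ V x ∈ closure (toWeakSpace ℝ V '' A)) (Φ : Finset (StrongDual ℝ V))
    {ε : ℝ} (hε : 0 < ε) : ∃ a ∈ A, ∀ φ ∈ Φ, |φ a - φ x| < ε := by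
  have hU : ∀ᶠ y in 𝓝 (toWeakSpace ℝ V x), ∀ φ ∈ Φ,
      |φ ((toWeakSpace ℝ V).symm y) - φ x| < ε := by
    rw [Filter.eventually_all_finset]
    intro φ _
    have h := ((continuous_weakSpace_eval φ).sub (continuous_const (y := φ x))).abs.continuousAt
      (x := toWeakSpace ℝ V x)
    refine h.eventually_lt_const ?_
    simpa using hε
  obtain ⟨y, ⟨a, ha, rfl⟩, hy⟩ := ((mem_closure_iff_frequently.1 hx).and_eventually hU).exists
  exact ⟨a, ha, by simpa using hy⟩

theorem isClosed_toWeakSpace_image_submodule {W : Submodule ℝ V} (hW : IsClosed (W : Set V)) :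
    IsClosed (toWeakSpace ℝ V '' (W : Set V)) := by
  rw [← closure_eq_iff_isClosed, ← W.convex.toWeakSpace_closure ℝ, hW.closure_eq]

/-- In a reflexive space, every point of the weak closure of a bounded set is the weak limit of a
sequence in that set. -/
theorem IsReflexiveSpace.exists_seq_weaklyTendsto (hV : IsReflexiveSpace V) {A : Set V}
    (hA : Bornology.IsBounded A) {x : V}
    (hx : toWeakSpace ℝ V x ∈ closure (toWeakSpace ℝ V '' A)) :
    ∃ u : ℕ → V, (∀ n, u n ∈ A) ∧ WeaklyTendsto u x := by
  classical
  have hN : ∀ t : Finset V, ∃ Φ : Finset (StrongDual ℝ V),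
      ∀ w ∈ Submodule.span ℝ (t : Set V), ∃ φ ∈ Φ, ‖φ‖ ≤ 1 ∧ ‖w‖ ≤ 2 * φ w :=
    fun t => exists_finset_dual_norming _
  choose N hN using hN
  choose pick hpickA hpick using fun (Φ : Finset (StrongDual ℝ V)) (n : ℕ) =>
    exists_mem_forall_abs_sub_lt hx Φ (Nat.one_div_pos_of_nat (α := ℝ) (n := n))
  let N' : Finset V → Finset (StrongDual ℝ V) := fun t => t.powerset.biUnion N
  obtain ⟨D, hD0, hDsucc⟩ : ∃ D : ℕ → Finset V,
      D 0 = {x} ∧ ∀ n, D (n + 1) = insert (pick (N' (D n)) n) (D n) :=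
    ⟨fun n => Nat.rec {x} (fun k t => insert (pick (N' t) k) t) n, rfl, fun _ => rfl⟩
  let u : ℕ → V := fun n => pick (N' (D n)) n
  have hDmono : Monotone D := monotone_nat_of_le_succ fun n => by
    rw [hDsucc]; exact Finset.subset_insert _ _
  have hN'mono : Monotone N' := fun s t h =>
    Finset.biUnion_subset_biUnion_of_subset_left _ (Finset.powerset_mono.2 h)
  have hconv : ∀ m, ∀ φ ∈ N' (D m), Tendsto (fun n => φ (u n)) atTop (𝓝 (φ x)) := by
    intro m φ hφ
    rw [tendsto_iff_dist_tendsto_zero]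
    refine squeeze_zero' (Eventually.of_forall fun n => dist_nonneg) ?_
      (tendsto_one_div_add_atTop_nhds_zero_nat (𝕜 := ℝ))
    filter_upwards [eventually_ge_atTop m] with n hn
    exact (hpick _ n φ (hN'mono (hDmono hn) hφ)).le
  let W₀ : Submodule ℝ V := ⨆ n, Submodule.span ℝ (D n : Set V)
  let W : Submodule ℝ V := W₀.topologicalClosure
  have hDW : ∀ n, ∀ y ∈ D n, y ∈ W := fun n y hy =>
    W₀.le_topologicalClosure (Submodule.mem_iSup_of_mem n (Submodule.subset_span hy))
  have hsep : ∀ w ∈ W, (∀ m, ∀ φ ∈ N' (D m), φ w = 0) → w = 0 := by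
    intro w hw hφ
    by_contra hw0
    have hpos : 0 < ‖w‖ := norm_pos_iff.2 hw0
    obtain ⟨v, hv, hvw⟩ := Metric.mem_closure_iff.1 hw (‖w‖ / 3) (by positivity)
    have hdir : Directed (· ≤ ·) fun n => Submodule.span ℝ (D n : Set V) :=
      Monotone.directed_le fun a b h => Submodule.span_mono (by exact_mod_cast hDmono h)
    obtain ⟨n, hn⟩ := (Submodule.mem_iSup_of_directed _ hdir).1 hv
    obtain ⟨φ, hφN, hφ1, hφv⟩ := hN (D n) v hn
    have hφw : φ w = 0 := hφ n φ (Finset.mem_biUnion.2 ⟨D n, by simp, hφN⟩)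
    have h1 : φ v ≤ ‖v - w‖ := by
      have := (le_abs_self _).trans (φ.le_of_opNorm_le hφ1 (v - w))
      simpa [hφw] using this
    have h2 : ‖w‖ ≤ ‖v‖ + ‖v - w‖ := by
      have := norm_sub_le v (v - w); simpa using this
    rw [dist_comm, dist_eq_norm] at hvw
    linarith
  refine ⟨u, fun n => hpickA _ _, ?_⟩
  refine (hV.isCompact_closure_toWeakSpace_image hA).tendsto_nhds_of_unique_mapClusterPt
    (Eventually.of_forall fun n => subset_closure ⟨u n, hpickA _ _, rfl⟩) ?_
  intro y _ hy
  obtain ⟨y, rfl⟩ := (toWeakSpace ℝ V).surjective y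
  have hyW : y ∈ W := by
    have := (isClosed_toWeakSpace_image_submodule
      W₀.isClosed_topologicalClosure).mem_of_mapClusterPt hy
      (Eventually.of_forall fun n => ⟨u n, hDW (n + 1) _
        (by rw [hDsucc]; exact Finset.mem_insert_self _ _), rfl⟩)
    exact (toWeakSpace ℝ V).injective.mem_set_image.1 this
  have hxW : x ∈ W := hDW 0 x (by simp [hD0])
  congr 1
  rw [← sub_eq_zero]
  refine hsep _ (W.sub_mem hyW hxW) fun m φ hφ => ?_
  rw [map_sub, sub_eq_zero]
  have h1 : MapClusterPt (φ y) atTop fun n => φ (u n) :=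
    MapClusterPt.continuousAt_comp (f := fun z : WeakSpace ℝ V => φ ((toWeakSpace ℝ V).symm z))
      (continuous_weakSpace_eval φ).continuousAt hy
  have h2 : ClusterPt (φ y) (𝓝 (φ x)) := h1.clusterPt.mono (hconv m φ hφ)
  exact eq_of_nhds_neBot h2

/-- In a reflexive space, bounded sequentially weakly closed sets are weakly compact. -/
theorem IsReflexiveSpace.isCompact_toWeakSpace_image (hV : IsReflexiveSpace V) {A : Set V}
    (hA : Bornology.IsBounded A)
    (hseq : ∀ (u : ℕ → V) (x : V), (∀ n, u n ∈ A) → WeaklyTendsto u x → x ∈ A) :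
    IsCompact (toWeakSpace ℝ V '' A) := by
  have hcl : closure (toWeakSpace ℝ V '' A) ⊆ toWeakSpace ℝ V '' A := by
    intro y hy
    obtain ⟨x, rfl⟩ := (toWeakSpace ℝ V).surjective y
    obtain ⟨u, huA, hux⟩ := hV.exists_seq_weaklyTendsto hA hy
    exact ⟨x, hseq u x huA hux, rfl⟩
  rw [subset_closure.antisymm hcl]
  exact hV.isCompact_closure_toWeakSpace_image hA

end

section

variable {V E : Type*} [NormedAddCommGroup V] [NormedSpace ℝ V]
  [NormedAddCommGroup E] [NormedSpace ℝ E]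

theorem WeaklyTendsto.tendsto_dual {u : ℕ → V} {x : V} (h : WeaklyTendsto u x)
    (φ : StrongDual ℝ V) : Tendsto (fun n => φ (u n)) atTop (𝓝 (φ x)) :=
  ((continuous_weakSpace_eval φ).tendsto _).comp h

theorem WeaklyTendsto.mem_closedBall {u : ℕ → V} {x x₀ : V} {ρ : ℝ} (h : WeaklyTendsto u x)
    (hu : ∀ n, u n ∈ Metric.closedBall x₀ ρ) : x ∈ Metric.closedBall x₀ ρ := by
  have hcl : IsClosed (toWeakSpace ℝ V '' Metric.closedBall x₀ ρ) := by
    rw [← closure_eq_iff_isClosed, ← (convex_closedBall x₀ ρ).toWeakSpace_closure ℝ,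
      Metric.isClosed_closedBall.closure_eq]
  exact (toWeakSpace ℝ V).injective.mem_set_image.1
    (hcl.mem_of_tendsto h (Eventually.of_forall fun n => mem_image_of_mem _ (hu n)))

theorem SeqWeaklyLowerSemicontinuousOn.le_of_weaklyTendsto {I : V → ℝ} {X : Set V}
    (hI : SeqWeaklyLowerSemicontinuousOn I X) {u : ℕ → V} {x : V} (hu : ∀ n, u n ∈ X)
    (hx : x ∈ X) (hux : WeaklyTendsto u x) {b : ℕ → ℝ} {c : ℝ} (hb : Tendsto b atTop (𝓝 c))
    (hle : ∀ n, I (u n) ≤ b n) : I x ≤ c := by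
  by_contra! hlt
  obtain ⟨d, hcd, hdI⟩ := exists_between hlt
  have h1 : ((d : ℝ) : EReal) < liminf (fun n => ((I (u n) : ℝ) : EReal)) atTop :=
    (EReal.coe_lt_coe_iff.2 hdI).trans_le (hI u x hu hx hux)
  obtain ⟨n, hn, hn'⟩ :=
    ((eventually_lt_of_lt_liminf h1).and (hb.eventually_lt_const hcd)).exists
  exact absurd (EReal.coe_lt_coe_iff.1 hn) ((hle n).trans hn'.le).not_gt

theorem HasGateauxDerivAt.eq_zero_of_isMinOn {f : V → ℝ} {f' : StrongDual ℝ V} {X : Set V} {x : V}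
    (hf : HasGateauxDerivAt f f' x) (hX : X ∈ 𝓝 x) (hmin : IsMinOn f X x) : f' = 0 := by
  ext v
  have hloc : IsLocalMin (fun t : ℝ => f (x + t • v)) 0 := by
    have hc : Tendsto (fun t : ℝ => x + t • v) (𝓝 0) (𝓝 x) := by
      have : Continuous fun t : ℝ => x + t • v := by fun_prop
      simpa using this.tendsto 0
    filter_upwards [hc hX] with t ht
    simpa using hmin ht
  simpa using hloc.hasDerivAt_eq_zero (hf v)

theorem HasGateauxDerivAt.add {F : Type*} [NormedAddCommGroup F] [NormedSpace ℝ F] {f g : V → F}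
    {f' g' : V →L[ℝ] F} {x : V} (hf : HasGateauxDerivAt f f' x) (hg : HasGateauxDerivAt g g' x) :
    HasGateauxDerivAt (fun y => f y + g y) (f' + g') x :=
  fun v => HasDerivAt.add (hf v) (hg v)

theorem HasGateauxDerivAt.clm_comp {f : V → E} {f' : V →L[ℝ] E} {x : V}
    (hf : HasGateauxDerivAt f f' x) (η : StrongDual ℝ E) :
    HasGateauxDerivAt (fun y => η (f y)) (η.comp f') x :=
  fun v => η.hasFDerivAt.comp_hasDerivAt _ (hf v)

/-- Sublevel sets of a perturbed coercive functional on a ball of a reflexive space are weakly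
compact. -/
theorem IsReflexiveSpace.isCompact_sublevel (hV : IsReflexiveSpace V) {x₀ : V} {r : ℝ}
    {γ : ℝ → ℝ} (hγ : Tendsto γ (𝓝[<] r) atTop) {I : V → ℝ} {ψ : V → E}
    (hIlsc : SeqWeaklyLowerSemicontinuousOn I (Metric.ball x₀ r))
    (hψcont : SeqWeaklyContinuousOn ψ (Metric.ball x₀ r))
    (hbdd : Bornology.IsBounded (ψ '' Metric.ball x₀ r))
    (hIγ : ∀ x ∈ Metric.ball x₀ r, γ ‖x - x₀‖ ≤ I x) (η : StrongDual ℝ E) (e : E) (c : ℝ) :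
    IsCompact (toWeakSpace ℝ V '' {x ∈ Metric.ball x₀ r | I x + η (ψ x - e) ≤ c}) := by
  obtain ⟨B, hB⟩ := hbdd.exists_norm_le
  obtain ⟨ρ, hρ, hργ⟩ := mem_nhdsLT_iff_exists_Ioo_subset.1
    (hγ.eventually_gt_atTop (c + ‖η‖ * (B + ‖e‖)))
  have hsub : ∀ x ∈ {x ∈ Metric.ball x₀ r | I x + η (ψ x - e) ≤ c},
      x ∈ Metric.closedBall x₀ ρ := by
    rintro x ⟨hx, hxc⟩
    rw [mem_closedBall_iff_norm]
    by_contra! hlt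
    have h1 : c + ‖η‖ * (B + ‖e‖) < γ ‖x - x₀‖ := hργ ⟨hlt, mem_ball_iff_norm.1 hx⟩
    have h2 : ‖ψ x - e‖ ≤ B + ‖e‖ :=
      (norm_sub_le _ _).trans (by gcongr; exact hB _ (mem_image_of_mem _ hx))
    have h3 : |η (ψ x - e)| ≤ ‖η‖ * (B + ‖e‖) := (η.le_opNorm _).trans (by gcongr)
    linarith [neg_abs_le (η (ψ x - e)), hIγ x hx]
  refine hV.isCompact_toWeakSpace_image (Metric.isBounded_ball.subset fun x hx => hx.1) ?_
  intro u x hu hux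
  have hx : x ∈ Metric.ball x₀ r :=
    Metric.closedBall_subset_ball hρ (hux.mem_closedBall fun n => hsub _ (hu n))
  refine ⟨hx, ?_⟩
  have hlim : Tendsto (fun n => c - η (ψ (u n) - e)) atTop (𝓝 (c - η (ψ x - e))) := by
    have := (hψcont u x (fun n => (hu n).1) hx hux).tendsto_dual η
    simp only [map_sub]
    exact tendsto_const_nhds.sub (this.sub tendsto_const_nhds)
  have := hIlsc.le_of_weaklyTendsto (fun n => (hu n).1) hx hux hlim
    (fun n => le_sub_iff_add_le.2 (hu n).2)
  linarith

theorem WeakStarDense.exists_lt_apply {S : Set (StrongDual ℝ E)} (hS : WeakStarDense S) {w : E}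
    (hw : w ≠ 0) (C : ℝ) : ∃ η ∈ S, C < η w := by
  have hopen : IsOpen {φ : WeakDual ℝ E | C < φ w} :=
    isOpen_lt continuous_const (WeakDual.eval_continuous w)
  have hne : {φ : WeakDual ℝ E | C < φ w}.Nonempty := by
    have hw' : ‖w‖ ≠ 0 := norm_ne_zero_iff.2 hw
    obtain ⟨φ, -, hφ⟩ := exists_dual_vector ℝ w hw'
    refine ⟨StrongDual.toWeakDual (((C + 1) / ‖w‖) • φ), ?_⟩
    change C < (C + 1) / ‖w‖ * φ w
    rw [hφ, RCLike.ofReal_real_eq_id, id, div_mul_cancel₀ _ hw']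
    linarith
  obtain ⟨_, hφ, η, hη, rfl⟩ := hS.inter_open_nonempty _ hopen hne
  exact ⟨η, hη, hφ⟩

/-- Some functional `I + η ∘ ψ` with `η ∈ S` has two distinct global minimisers. -/
theorem exists_two_minimizers (hV : IsReflexiveSpace V) {x₀ : V} {r : ℝ}
    {γ : ℝ → ℝ} (hγ : Tendsto γ (𝓝[<] r) atTop) {I : V → ℝ} {ψ : V → E}
    (hIlsc : SeqWeaklyLowerSemicontinuousOn I (Metric.ball x₀ r))
    (hψcont : SeqWeaklyContinuousOn ψ (Metric.ball x₀ r))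
    (hbdd : Bornology.IsBounded (ψ '' Metric.ball x₀ r))
    (hnonconv : ¬ Convex ℝ (ψ '' Metric.ball x₀ r))
    (hIγ : ∀ x ∈ Metric.ball x₀ r, γ ‖x - x₀‖ ≤ I x)
    {S : Set (StrongDual ℝ E)} (hSconv : Convex ℝ S) (hSdense : WeakStarDense S) :
    ∃ η ∈ S, ∃ x₁ ∈ Metric.ball x₀ r, ∃ x₂ ∈ Metric.ball x₀ r, x₁ ≠ x₂ ∧
      IsMinOn (fun x => I x + η (ψ x)) (Metric.ball x₀ r) x₁ ∧
      IsMinOn (fun x => I x + η (ψ x)) (Metric.ball x₀ r) x₂ := by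
  by_contra! hcon
  simp only [Convex, StarConvex, not_forall] at hnonconv
  obtain ⟨_, ⟨a, ha, rfl⟩, _, ⟨b, hb, rfl⟩, α, β, hα, hβ, hαβ, he⟩ := hnonconv
  set e := α • ψ a + β • ψ b with he_def
  let T := toWeakSpace ℝ V
  let L : WeakSpace ℝ V → StrongDual ℝ E →ₗ[ℝ] ℝ := fun x =>
    (NormedSpace.inclusionInDoubleDual ℝ E (ψ (T.symm x) - e)).toLinearMap
  have hL : ∀ x η, L (T x) η = η (ψ x - e) := fun x η => rfl
  have hSne : S.Nonempty := image_nonempty.1 hSdense.nonempty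
  obtain ⟨x, hx, hxM⟩ := exists_forall_le_of_unique_minimizer (s := T '' Metric.ball x₀ r)
    (M := max (I a) (I b)) hSconv hSne (fun x => I (T.symm x)) L (by
      intro η _ c
      convert hV.isCompact_sublevel hγ hIlsc hψcont hbdd hIγ η e c using 1
      ext y
      constructor
      · rintro ⟨⟨x, hx, rfl⟩, hc⟩
        exact ⟨x, ⟨hx, hc⟩, rfl⟩
      · rintro ⟨x, ⟨hx, hc⟩, rfl⟩
        exact ⟨⟨x, hx, rfl⟩, hc⟩)
    (by
      rintro η hη _ ⟨x, hx, rfl⟩ _ ⟨y, hy, rfl⟩ hxmin hymin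
      have hmin : ∀ x, IsMinOn (fun z => I (T.symm z) + L z η) (T '' Metric.ball x₀ r) (T x) →
          IsMinOn (fun x => I x + η (ψ x)) (Metric.ball x₀ r) x := by
        intro x hx z hz
        have := hx (mem_image_of_mem T hz)
        simp only [mem_ofPred_eq, hL, LinearEquiv.symm_apply_apply, map_sub] at this ⊢
        linarith
      by_contra hne
      exact hcon η hη x hx y hy (fun h => hne (h ▸ rfl)) (hmin x hxmin) (hmin y hymin))
    (by
      intro η _
      by_contra! hlt
      have h1 := hlt _ (mem_image_of_mem T ha)
      have h2 := hlt _ (mem_image_of_mem T hb)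
      simp only [hL, LinearEquiv.symm_apply_apply] at h1 h2
      have h3 : 0 < η (ψ a - e) := by linarith [le_max_left (I a) (I b)]
      have h4 : 0 < η (ψ b - e) := by linarith [le_max_right (I a) (I b)]
      have h5 : α * η (ψ a - e) + β * η (ψ b - e) = 0 := by
        simp only [he_def, map_sub, map_add, map_smul, smul_eq_mul]
        linear_combination (-(α * η (ψ a) + β * η (ψ b))) * hαβ
      rcases hα.eq_or_lt with rfl | hα
      · have : β = 1 := by linarith
        subst this
        linarith
      · nlinarith [mul_pos hα h3, mul_nonneg hβ h4.le])
  obtain ⟨x, hxball, rfl⟩ := hx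
  have hw : ψ x - e ≠ 0 := fun h => he (sub_eq_zero.1 h ▸ mem_image_of_mem ψ hxball)
  obtain ⟨η, hη, hlt⟩ := hSdense.exists_lt_apply hw (max (I a) (I b) - I x)
  have := hxM η hη
  simp only [hL, LinearEquiv.symm_apply_apply] at this
  linarith

end

theorem theorem2p7 {V E : Type*} [NormedAddCommGroup V] [NormedSpace ℝ V] [CompleteSpace V]
    [NormedAddCommGroup E] [NormedSpace ℝ E]
    (hV : IsReflexiveSpace V) (x₀ : V) (r : ℝ) (hr : 0 < r)
    (γ : ℝ → ℝ) (hγ : Tendsto γ (𝓝[<] r) atTop)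
    (I : V → ℝ) (ψ : V → E)
    (hI : GateauxDifferentiableOn I (Metric.ball x₀ r))
    (hψ : GateauxDifferentiableOn ψ (Metric.ball x₀ r))
    (hIlsc : SeqWeaklyLowerSemicontinuousOn I (Metric.ball x₀ r))
    (hψcont : SeqWeaklyContinuousOn ψ (Metric.ball x₀ r))
    (hbdd : Bornology.IsBounded (ψ '' Metric.ball x₀ r))
    (hnonconv : ¬ Convex ℝ (ψ '' Metric.ball x₀ r))
    (hIγ : ∀ x ∈ Metric.ball x₀ r, γ ‖x - x₀‖ ≤ I x)
    (S : Set (StrongDual ℝ E)) (hSconv : Convex ℝ S) (hSdense : WeakStarDense S) :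
    ∃ η ∈ S, ∃ x₁ ∈ Metric.ball x₀ r, ∃ x₂ ∈ Metric.ball x₀ r, x₁ ≠ x₂ ∧
      ∀ x ∈ ({x₁, x₂} : Set V), ∃ dI dηψ : StrongDual ℝ V,
        HasGateauxDerivAt I dI x ∧ HasGateauxDerivAt (fun y => η (ψ y)) dηψ x ∧
          dI + dηψ = 0 := by
  obtain ⟨η, hη, x₁, hx₁, x₂, hx₂, hne, hmin₁, hmin₂⟩ :=
    exists_two_minimizers hV hγ hIlsc hψcont hbdd hnonconv hIγ hSconv hSdense
  have hcrit : ∀ x ∈ Metric.ball x₀ r,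
      IsMinOn (fun x => I x + η (ψ x)) (Metric.ball x₀ r) x → ∃ dI dηψ : StrongDual ℝ V,
        HasGateauxDerivAt I dI x ∧ HasGateauxDerivAt (fun y => η (ψ y)) dηψ x ∧
          dI + dηψ = 0 := by
    intro x hx hmin
    obtain ⟨dI, hdI⟩ := hI x hx
    obtain ⟨dψ, hdψ⟩ := hψ x hx
    have hdηψ := hdψ.clm_comp η
    exact ⟨dI, η.comp dψ, hdI, hdηψ,
      (hdI.add hdηψ).eq_zero_of_isMinOn (Metric.isOpen_ball.mem_nhds hx) hmin⟩
  refine ⟨η, hη, x₁, hx₁, x₂, hx₂, hne, ?_⟩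
  rintro x (rfl | rfl)
  · exact hcrit x hx₁ hmin₁
  · exact hcrit x hx₂ hmin₂
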